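/- A signed graph $(G,\sigma)$ is a finite simple graph $G$ together with a signature $\sigma:E(G)\to\{+,-\}$. The sign of a closed walk of $G$ is the product of the signs of its edges, counted with multiplicity. A homomorphism of $(G,\sigma)$ to $(H,\pi)$ is a mapping $f:V(G)\to V(H)$ that preserves adjacencies and the signs of closed walks: $f(u)f(v)\in E(H)$ for every $uv\in E(G)$, and every closed walk of $G$ has the same sign in $(G,\sigma)$ as its image under $f$ has in $(H,\pi)$. An isomorphism is a bijective homomorphism whose inverse is also a homomorphism. Let $(SP_5^+,\square^+)$ be the signed complete graph on the six vertices $\mathbb{F}_5\cup\{\infty\}$ in which every edge incident with $\infty$ is positive and, for distinct $u,v\in\mathbb{F}_5$, the edge $uv$ is positive if $u-v$ is a square in $\mathbb{F}_5$ and negative otherwise. **Theorem.** Let $(G,\sigma)$ be a signed graph in which every vertex of $G$ has degree at most $3$. If no connected component of $(G,\sigma)$ is isomorphic, as a signed graph, to the complete graph $K_4$ with all edges positive or to $K_4$ with all edges negative, then $(G,\sigma)$ admits a homomorphism to $(SP_5^+,\square^+)$. -/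

import Mathlib

/-- A (simple) signed graph on the vertex set `V`: a simple graph together with a signature, that is,
a function from its edges to the two signs `1` and `-1`. The sign of an edge is given as a function
of its two ends (and of a proof that they are adjacent) that does not depend on their order. -/
structure SignedGraph (V : Type*) where
  graph : SimpleGraph V
  sign : ∀ u v : V, graph.Adj u v → ℤˣ
  sign_symm : ∀ (u v : V) (h : graph.Adj u v), sign u v h = sign v u h.symm

namespace SignedGraph

/-- The sign of a walk: the product of the signs of its edges, counted with multiplicity.
It is `1` if and only if the number of negative edges is even. -/
def walkSign {V : Type*} (S : SignedGraph V) : {u v : V} → S.graph.Walk u v → ℤˣ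
  | _, _, .nil => 1
  | _, _, .cons h p => S.sign _ _ h * S.walkSign p

/-- An adjacency-preserving vertex-mapping is a homomorphism of signed graphs if it preserves the
signs of closed walks. -/
def IsHom {V W : Type*} (S : SignedGraph V) (T : SignedGraph W) (f : S.graph →g T.graph) : Prop :=
  ∀ (v : V) (p : S.graph.Walk v v), T.walkSign (p.map f) = S.walkSign p

/-- `S` admits a homomorphism to `T`. -/
def AdmitsHom {V W : Type*} (S : SignedGraph V) (T : SignedGraph W) : Prop :=
  ∃ f : S.graph →g T.graph, S.IsHom T f

/-- Two signed graphs are isomorphic if there is a bijective homomorphism between them whose inverse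
is also a homomorphism. -/
def Isomorphic {V W : Type*} (S : SignedGraph V) (T : SignedGraph W) : Prop :=
  ∃ e : S.graph ≃g T.graph, S.IsHom T e.toHom ∧ T.IsHom S e.symm.toHom

/-- The signed subgraph induced by a set of vertices. -/
def induce {V : Type*} (S : SignedGraph V) (s : Set V) : SignedGraph s where
  graph := S.graph.induce s
  sign u v h := S.sign u v h
  sign_symm u v h := S.sign_symm u v h

/-- The complete signed graph on `V` all of whose edges have the sign `ε`. -/
def complete (V : Type*) (ε : ℤˣ) : SignedGraph V where
  graph := ⊤
  sign _ _ _ := ε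
  sign_symm _ _ _ := rfl

theorem isSquare_sub_comm {F : Type*} [Field F] [Fintype F] (hF : Fintype.card F % 4 = 1)
    (u v : F) : IsSquare (u - v) ↔ IsSquare (v - u) := by
  have h : IsSquare (-1 : F) := FiniteField.isSquare_neg_one_iff.2 (by omega)
  constructor
  · intro h'
    simpa using h.mul h'
  · intro h'
    simpa using h.mul h'

/-- The signed Paley graph of order `q`, for a finite field with `q ≡ 1 mod 4` elements: any two
distinct elements are adjacent, through a positive edge if their difference is a square and through
a negative edge otherwise. -/
def paley (F : Type*) [Field F] [Fintype F] [DecidableEq F] (hF : Fintype.card F % 4 = 1) :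
    SignedGraph F where
  graph := ⊤
  sign u v _ := if IsSquare (u - v) then 1 else -1
  sign_symm u v _ := by simp only [isSquare_sub_comm hF u v]

/-- The signed graph obtained from `S` by adding a vertex `∞` (here `none`) and joining it to every
other vertex through a positive edge. -/
def plus {V : Type*} (S : SignedGraph V) : SignedGraph (Option V) where
  graph :=
    { Adj := fun
        | none, none => False
        | none, some _ => True
        | some _, none => True
        | some u, some v => S.graph.Adj u v
      symm := ⟨by
        rintro (_ | u) (_ | v) h
        · exact h
        · trivial
        · trivial
        · exact S.graph.adj_symm h⟩
      loopless := ⟨by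
        rintro (_ | u) h
        · exact h
        · exact S.graph.loopless.irrefl u h⟩ }
  sign := fun
    | none, none, _ => 1
    | none, some _, _ => 1
    | some _, none, _ => 1
    | some u, some v, h => S.sign u v h
  sign_symm := by
    rintro (_ | u) (_ | v) h
    · rfl
    · rfl
    · rfl
    · exact S.sign_symm u v h

instance fact_prime_five : Fact (Nat.Prime 5) := ⟨by norm_num⟩

/-- The signed Paley plus graph of order `6`, built on the field `ZMod 5`. -/
def SP5plus : SignedGraph (Option (ZMod 5)) :=
  (paley (ZMod 5) (by rw [ZMod.card])).plus

end SignedGraph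

/-! The double cover of the target is the icosahedron, with antipodal vertices over the same vertex;
a pair of antipodes is called a line, and there are six. A homomorphism is obtained from a map `f`
to the icosahedron in which `f u` is adjacent to `f v` when `uv` is positive and to the antipode of
`f v` when `uv` is negative: the sheet of `f v` serves as a switching function.

Such a map is built by induction on the number of non-isolated vertices. The excluded signed `K₄`
are replaced by the switching-invariant `IsUniformK4`. A vertex of degree one is removed. Otherwise
a chordless cycle exists, and each of its vertices has at most one neighbour outside it. Once the
rest is coloured, the `i`-th cycle vertex needs a colour adjacent to a prescribed vertex `x i`.

For length at least four such a choice always exists (`icoCloses`). For a triangle it fails only if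
the `x i` lie on one line, with matching signs (`icoCloses_two`). If two outer neighbours are
distinct, an edge added between them, suitably signed (`exists_sign_edge`), forces two lines. If a
triangle vertex has no outer neighbour, its `x i` is free. If all three share one outer neighbour,
failure would make the resulting `K₄` uniform. -/

namespace SignedGraph

/-! ### The icosahedron and the finite verifications on it. -/

/-- The neighbourhoods, as bit masks, of the twelve vertices of the double cover of `SP5plus`:
the vertices `i` and `i + 6` lie over the same vertex of `SP5plus`, with opposite signs, and
`5` lies over `∞`. The double cover is the graph of the icosahedron. -/
def nbrMask (i : ℕ) : ℕ :=
  [818, 1573, 1130, 244, 425, 31, 3212, 2392, 2705, 3331, 2630, 1984].getD i 0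

/-- Adjacency in the double cover of `SP5plus`. -/
def icoAdj (i j : Fin 12) : Bool := (nbrMask i).testBit j

theorem icoAdj_comm : ∀ i j, icoAdj i j = icoAdj j i := by decide +kernel

theorem icoAdj_antipode : ∀ i j, icoAdj (i + 6) j = icoAdj i (j + 6) := by decide +kernel

/-- The union of the neighbourhoods of the elements of a set, given as a bit mask. -/
def nbrsMask (S : ℕ) : ℕ :=
  (List.range 12).foldl (fun r i => if S.testBit i then r ||| nbrMask i else r) 0

/-- The neighbours of `y` that have a neighbour in the set `S`. -/
def advance (S y : ℕ) : ℕ := nbrsMask S &&& nbrMask y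

/-- The sets of all neighbours of `y` but one. -/
def strongSets (y : ℕ) : List ℕ :=
  ((List.range 12).filter (nbrMask y).testBit).map fun i => nbrMask y - 2 ^ i

/-- For distinct neighbours `p`, `q` of the vertex `5`, the lines are partitioned into three pairs,
the first of which is `{p, q}` and the last of which contains `5`. -/
def lineClass (p q i : ℕ) : ℕ :=
  let l := i % 6
  if l = p ∨ l = q then 0 else if l = 5 ∨ l = 3 * (p + q) % 5 then 2 else 1

/-- The sets of all neighbours of `y` but two, except that the two missing neighbours must not
form the pair of lines that follows the pair of `y`. -/
def weakSets (p q y : ℕ) : List ℕ :=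
  let L := (List.range 12).filter (nbrMask y).testBit
  let c := (lineClass p q y + 1) % 3
  L.flatMap fun i => (L.filter fun j => j < i && !(lineClass p q i == c && lineClass p q j == c)).map
    fun j => nbrMask y - 2 ^ i - 2 ^ j

/-- `S` contains a member of the list `L`. -/
def containsSome (L : List ℕ) (S : ℕ) : Bool := L.any fun T => T &&& S == T

/-- `S` has an element adjacent to `p`. -/
def meetsNbrs (S p : ℕ) : Bool := S &&& nbrMask p != 0

/-- The entry at `p` of `L` stands for the set of vertices reachable from `p`. -/
def robust (y : ℕ) (L : List ℕ) : Bool :=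
  (List.range 5).any fun p => containsSome (strongSets y) (L.getD p 0) &&
    (List.range 5).any fun q => q != p && containsSome (weakSets p q y) (L.getD q 0)

def closable (e : ℕ) (L : List ℕ) : Bool :=
  (List.range 5).any fun p => meetsNbrs (L.getD p 0) (p + e)

/-- The first exception asks for a triangle inside the neighbourhood of `5`, which is a pentagon;
the second is the same after switching one vertex. -/
theorem closable_three : (List.range 12).all (fun a => (List.range 12).all fun b =>
    (closable 0 ((List.range 5).map fun p => advance (advance (2 ^ p) a) b) || (a == 5 && b == 5)) &&
    (closable 6 ((List.range 5).map fun p => advance (advance (2 ^ p) a) b) ||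
      (a == 11 && b == 5))) = true := by
  decide +kernel

theorem closable_four : (List.range 12).all (fun a => (List.range 12).all fun b =>
    (List.range 12).all fun c =>
    closable 0 ((List.range 5).map fun p => advance (advance (advance (2 ^ p) a) b) c) &&
    closable 6 ((List.range 5).map fun p => advance (advance (advance (2 ^ p) a) b) c)) = true := by
  decide +kernel

/-- Robustness may set in after three or after four steps; since it persists, it holds after four in
either case. -/
theorem robust_four_or_five : (List.range 12).all (fun a => (List.range 12).all fun b =>
    (List.range 12).all fun c =>
    robust c ((List.range 5).map fun p => advance (advance (advance (2 ^ p) a) b) c) ||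
    (List.range 12).all fun d =>
    robust d ((List.range 5).map fun p => advance (advance (advance (advance (2 ^ p) a) b) c) d)) =
      true := by
  decide +kernel

/-- Vertices that are neither equal nor antipodal have two common neighbours, so losing one
neighbour of `y` cuts off no further vertex: only the antipode of `y` can be missing among the
neighbours of `y'`. -/
theorem strongSets_advance : (List.range 12).all (fun y => (strongSets y).all fun S =>
    (List.range 12).all fun y' => containsSome (strongSets y') (advance S y')) = true := by
  decide +kernel

/-- Two lost neighbours of `y` have one common neighbour besides `y`, so at most it and the antipode
of `y` get lost. The point of the check is that these two never form the pair excluded at `y'`. -/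
theorem weakSets_advance : (List.range 5).all (fun p => (List.range 5).all fun q => p == q ||
    (List.range 12).all fun y => (weakSets p q y).all fun S =>
    (List.range 12).all fun y' => containsSome (weakSets p q y') (advance S y')) = true := by
  decide +kernel

/-- A strong set at `y` misses the neighbours of `p` only if `y` is the antipode of `p`. Then the
common neighbours of `y` and `q` lie on the two lines of class `1`, exactly the pair that a weak set
at `y` may not miss. The other sign is the antipodal statement. -/
theorem strongSets_weakSets_close : (List.range 5).all (fun p => (List.range 5).all fun q => p == q ||
    (List.range 12).all fun y => (strongSets y).all fun S => (weakSets p q y).all fun U =>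
    (meetsNbrs S p || meetsNbrs U q) && (meetsNbrs S (p + 6) || meetsNbrs U (q + 6))) = true := by
  decide +kernel

/-! ### Walks through prescribed neighbourhoods, starting next to the vertex `5`. -/

/-- There is a walk `z 0, …, z i` from `p` to `j` with `z m` adjacent to `x m` for `0 < m ≤ i`. -/
def IcoReach (x : ℕ → Fin 12) (p : Fin 12) (i : ℕ) (j : Fin 12) : Prop :=
  ∃ z : ℕ → Fin 12, z 0 = p ∧ z i = j ∧ (∀ m < i, icoAdj (z m) (z (m + 1))) ∧
    ∀ m < i, icoAdj (z (m + 1)) (x (m + 1))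

def IcoCovers (x : ℕ → Fin 12) (p : Fin 12) (i S : ℕ) : Prop :=
  ∀ j : Fin 12, S.testBit j → IcoReach x p i j

theorem IcoReach.succ {x : ℕ → Fin 12} {p : Fin 12} {i : ℕ} {j k : Fin 12} (h : IcoReach x p i j)
    (hk : icoAdj j k) (hx : icoAdj k (x (i + 1))) : IcoReach x p (i + 1) k := by
  obtain ⟨z, h0, hi, h1, h2⟩ := h
  refine ⟨fun m => if m ≤ i then z m else k, by simp [h0], by simp, fun m hm => ?_, fun m hm => ?_⟩
  · rcases Nat.lt_succ_iff_lt_or_eq.1 hm with h | rfl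
    · simpa [h.le, Nat.succ_le_of_lt h] using h1 m h
    · simpa [hi] using hk
  · rcases Nat.lt_succ_iff_lt_or_eq.1 hm with h | rfl
    · simpa [Nat.succ_le_of_lt h] using h2 m h
    · simpa using hx

theorem testBit_foldl_or (f : ℕ → ℕ) (S j : ℕ) (L : List ℕ) (r : ℕ)
    (h : (L.foldl (fun r i => if S.testBit i then r ||| f i else r) r).testBit j) :
    r.testBit j ∨ ∃ i ∈ L, S.testBit i ∧ (f i).testBit j := by
  induction L generalizing r with
  | nil => exact Or.inl h
  | cons a L ih =>
    rw [List.foldl_cons] at h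
    rcases ih _ h with h | ⟨i, hi, h⟩
    · split_ifs at h with ha
      · rw [Nat.testBit_or, Bool.or_eq_true] at h
        exact h.imp_right fun h => ⟨a, by simp, ha, h⟩
      · exact Or.inl h
    · exact Or.inr ⟨i, by simp [hi], h⟩

theorem IcoCovers.advance {x : ℕ → Fin 12} {p : Fin 12} {i S : ℕ} (h : IcoCovers x p i S) :
    IcoCovers x p (i + 1) (advance S (x (i + 1))) := by
  intro k hk
  rw [SignedGraph.advance, Nat.testBit_and, Bool.and_eq_true] at hk
  rcases testBit_foldl_or _ _ _ _ _ hk.1 with h0 | ⟨j, hj, hS, hjk⟩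
  · simp at h0
  · rw [List.mem_range] at hj
    refine (h ⟨j, hj⟩ hS).succ hjk ?_
    rw [icoAdj_comm]
    exact hk.2

theorem IcoCovers.of_containsSome {x : ℕ → Fin 12} {p : Fin 12} {i S : ℕ} {L : List ℕ}
    (h : IcoCovers x p i S) (hL : containsSome L S) : ∃ T ∈ L, IcoCovers x p i T := by
  obtain ⟨T, hT, hTS⟩ := List.any_eq_true.1 hL
  refine ⟨T, hT, fun j hj => h j ?_⟩
  rw [beq_iff_eq] at hTS
  rw [← hTS, Nat.testBit_and, Bool.and_eq_true] at hj
  exact hj.2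

theorem icoCovers_zero (x : ℕ → Fin 12) (p : Fin 12) : IcoCovers x p 0 (2 ^ (p : ℕ)) := by
  intro j hj
  have : j = p := by
    rw [Nat.testBit_two_pow] at hj
    exact Fin.ext (by simpa using hj : (p : ℕ) = j).symm
  exact ⟨fun _ => j, this, rfl, by simp, by simp⟩

theorem nbrMask_lt : ∀ i : Fin 12, nbrMask i < 2 ^ 12 := by decide

theorem IcoCovers.exists_of_meetsNbrs {x : ℕ → Fin 12} {p q : Fin 12} {i S : ℕ}
    (h : IcoCovers x p i S) (hS : meetsNbrs S q) : ∃ j, IcoReach x p i j ∧ icoAdj j q := by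
  rw [meetsNbrs, bne_iff_ne] at hS
  obtain ⟨j, hj⟩ := Nat.exists_testBit_of_ne_zero hS
  rw [Nat.testBit_and, Bool.and_eq_true] at hj
  have hlt : j < 12 := by
    by_contra hlt
    have := Nat.testBit_lt_two_pow ((nbrMask_lt q).trans_le
      (Nat.pow_le_pow_right (by norm_num) (not_lt.1 hlt)))
    simp [this] at hj
  refine ⟨⟨j, hlt⟩, h ⟨j, hlt⟩ hj.1, ?_⟩
  rw [icoAdj_comm]
  exact hj.2

/-- The antipodal map of the icosahedron if `ε = -1`, as a translation. -/
def twist (ε : ℤˣ) : Fin 12 := if ε = 1 then 0 else 6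

@[simp] theorem twist_one : twist 1 = 0 := rfl

theorem twist_mul : ∀ ε δ, twist (ε * δ) = twist ε + twist δ := by decide

@[simp] theorem twist_add_twist : ∀ ε, twist ε + twist ε = 0 := by decide

theorem icoAdj_twist (ε : ℤˣ) (i j : Fin 12) :
    icoAdj (i + twist ε) j = icoAdj i (j + twist ε) := by
  rcases Int.units_eq_one_or ε with rfl | rfl
  · simp
  · exact icoAdj_antipode i j

/-- A closed walk of length `n + 1` can be chosen in the neighbourhoods of `x 0, …, x n`, where the
last step of the walk has the sign `ε`. -/
def IcoCloses (x : ℕ → Fin 12) (n : ℕ) (ε : ℤˣ) : Prop :=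
  ∃ z : ℕ → Fin 12, (∀ i ≤ n, icoAdj (z i) (x i)) ∧ (∀ i < n, icoAdj (z i) (z (i + 1))) ∧
    icoAdj (z n) (z 0 + twist ε)

theorem IcoReach.closes {x : ℕ → Fin 12} {p j : Fin 12} {n : ℕ} {ε : ℤˣ} (h : IcoReach x p n j)
    (hp : icoAdj p (x 0)) (hj : icoAdj j (p + twist ε)) : IcoCloses x n ε := by
  obtain ⟨z, rfl, rfl, h1, h2⟩ := h
  refine ⟨z, fun i hi => ?_, h1, hj⟩
  cases i with
  | zero => exact hp
  | succ i => exact h2 i hi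

theorem IcoCovers.closes {x : ℕ → Fin 12} {p n S : ℕ} {ε : ℤˣ} (hp : p < 5)
    (h : IcoCovers x (Fin.ofNat 12 p) n S) (h0 : x 0 = 5)
    (hS : meetsNbrs S (p + (twist ε : ℕ))) : IcoCloses x n ε := by
  have key : ∀ p < 5, ∀ ε, icoAdj (Fin.ofNat 12 p) 5 ∧
      ((Fin.ofNat 12 p + twist ε : Fin 12) : ℕ) = p + (twist ε : ℕ) := by decide
  obtain ⟨h1, h2⟩ := key p hp ε
  rw [← h2] at hS
  obtain ⟨j, hj, hj'⟩ := h.exists_of_meetsNbrs hS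
  exact hj.closes (h0 ▸ h1) hj'

/-- The invariant that reduces cycles of every length to finite checks: it survives each step and
allows closing with either sign. -/
def RobustAt (x : ℕ → Fin 12) (n : ℕ) : Prop :=
  ∃ p < 5, ∃ q < 5, q ≠ p ∧
    (∃ S ∈ strongSets (x n), IcoCovers x (Fin.ofNat 12 p) n S) ∧
    ∃ U ∈ weakSets p q (x n), IcoCovers x (Fin.ofNat 12 q) n U

theorem robustAt_of_robust {x : ℕ → Fin 12} {n : ℕ} {F : ℕ → ℕ}
    (hF : ∀ p < 5, IcoCovers x (Fin.ofNat 12 p) n (F p))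
    (h : robust (x n) ((List.range 5).map F)) : RobustAt x n := by
  have key : ∀ p < 5, ((List.range 5).map F).getD p 0 = F p := by
    intro p hp
    simp [hp]
  obtain ⟨p, hp, h⟩ := List.any_eq_true.1 h
  rw [List.mem_range] at hp
  rw [Bool.and_eq_true] at h
  obtain ⟨q, hq, h'⟩ := List.any_eq_true.1 h.2
  rw [List.mem_range] at hq
  rw [Bool.and_eq_true, bne_iff_ne, key q hq] at h'
  rw [key p hp] at h
  exact ⟨p, hp, q, hq, h'.1, (hF p hp).of_containsSome h.1, (hF q hq).of_containsSome h'.2⟩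

theorem closes_of_closable {x : ℕ → Fin 12} {n : ℕ} {F : ℕ → ℕ} {ε : ℤˣ} (h0 : x 0 = 5)
    (hF : ∀ p < 5, IcoCovers x (Fin.ofNat 12 p) n (F p))
    (h : closable (twist ε) ((List.range 5).map F)) : IcoCloses x n ε := by
  obtain ⟨p, hp, h⟩ := List.any_eq_true.1 h
  rw [List.mem_range] at hp
  have : ((List.range 5).map F).getD p 0 = F p := by simp [hp]
  rw [this] at h
  exact (hF p hp).closes hp h0 h

theorem icoCovers_two (x : ℕ → Fin 12) {p : ℕ} (hp : p < 5) :
    IcoCovers x (Fin.ofNat 12 p) 2 (advance (advance (2 ^ p) (x 1)) (x 2)) := by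
  have h := icoCovers_zero x (Fin.ofNat 12 p)
  have hp' : ((Fin.ofNat 12 p : Fin 12) : ℕ) = p := Nat.mod_eq_of_lt (by omega)
  rw [hp'] at h
  exact h.advance.advance

theorem RobustAt.succ {x : ℕ → Fin 12} {n : ℕ} (h : RobustAt x n) : RobustAt x (n + 1) := by
  obtain ⟨p, hp, q, hq, hqp, ⟨S, hS, hpS⟩, U, hU, hqU⟩ := h
  refine ⟨p, hp, q, hq, hqp, hpS.advance.of_containsSome ?_, hqU.advance.of_containsSome ?_⟩
  · have h := List.all_eq_true.1 strongSets_advance _ (List.mem_range.2 (x n).2)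
    exact List.all_eq_true.1 (List.all_eq_true.1 h _ hS) _ (List.mem_range.2 (x (n + 1)).2)
  · have h := List.all_eq_true.1 (List.all_eq_true.1 weakSets_advance _ (List.mem_range.2 hp)) _
      (List.mem_range.2 hq)
    rw [Bool.or_eq_true, beq_iff_eq] at h
    have h := List.all_eq_true.1 (h.resolve_left hqp.symm) _ (List.mem_range.2 (x n).2)
    exact List.all_eq_true.1 (List.all_eq_true.1 h _ hU) _ (List.mem_range.2 (x (n + 1)).2)

theorem RobustAt.closes {x : ℕ → Fin 12} {n : ℕ} (h : RobustAt x n) (h0 : x 0 = 5) (ε : ℤˣ) :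
    IcoCloses x n ε := by
  obtain ⟨p, hp, q, hq, hqp, ⟨S, hS, hpS⟩, U, hU, hqU⟩ := h
  have h := List.all_eq_true.1 (List.all_eq_true.1 strongSets_weakSets_close _
    (List.mem_range.2 hp)) _ (List.mem_range.2 hq)
  rw [Bool.or_eq_true, beq_iff_eq] at h
  have h := List.all_eq_true.1 (h.resolve_left hqp.symm) _ (List.mem_range.2 (x n).2)
  have h := List.all_eq_true.1 (List.all_eq_true.1 h _ hS) _ hU
  rw [Bool.and_eq_true, Bool.or_eq_true, Bool.or_eq_true] at h
  rcases Int.units_eq_one_or ε with rfl | rfl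
  · exact h.1.elim (fun h => hpS.closes hp h0 h) fun h => hqU.closes hq h0 h
  · exact h.2.elim (fun h => hpS.closes hp h0 h) fun h => hqU.closes hq h0 h

theorem robustAt_four {x : ℕ → Fin 12} : RobustAt x 4 := by
  have h := List.all_eq_true.1 robust_four_or_five _ (List.mem_range.2 (x 1).2)
  have h := List.all_eq_true.1 h _ (List.mem_range.2 (x 2).2)
  have h := List.all_eq_true.1 h _ (List.mem_range.2 (x 3).2)
  rw [Bool.or_eq_true] at h
  rcases h with h | h
  · exact (robustAt_of_robust (fun p hp => (icoCovers_two x hp).advance) h).succ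
  · have h := List.all_eq_true.1 h _ (List.mem_range.2 (x 4).2)
    exact robustAt_of_robust (fun p hp => (icoCovers_two x hp).advance.advance) h

theorem icoCloses_of_zero {x : ℕ → Fin 12} (h0 : x 0 = 5) {n : ℕ} (hn : 3 ≤ n) (ε : ℤˣ) :
    IcoCloses x n ε := by
  rcases hn.eq_or_lt with rfl | hn
  · have h := List.all_eq_true.1 closable_four _ (List.mem_range.2 (x 1).2)
    have h := List.all_eq_true.1 h _ (List.mem_range.2 (x 2).2)
    have h := List.all_eq_true.1 h _ (List.mem_range.2 (x 3).2)
    rw [Bool.and_eq_true] at h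
    refine closes_of_closable h0 (fun p hp => (icoCovers_two x hp).advance) ?_
    rcases Int.units_eq_one_or ε with rfl | rfl
    exacts [h.1, h.2]
  · have : RobustAt x n := Nat.le_induction robustAt_four (fun n _ h => h.succ) n hn
    exact this.closes h0 ε

theorem icoCloses_two_of_zero {x : ℕ → Fin 12} (h0 : x 0 = 5) {ε : ℤˣ}
    (h : ¬ (x 1 = x 0 + twist ε ∧ x 2 = x 0)) : IcoCloses x 2 ε := by
  refine closes_of_closable h0 (fun p hp => icoCovers_two x hp) ?_
  have h' := List.all_eq_true.1 closable_three _ (List.mem_range.2 (x 1).2)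
  have h' := List.all_eq_true.1 h' _ (List.mem_range.2 (x 2).2)
  rw [Bool.and_eq_true, Bool.or_eq_true, Bool.or_eq_true] at h'
  rw [h0] at h
  rcases Int.units_eq_one_or ε with rfl | rfl
  · refine h'.1.resolve_right fun h'' => h ?_
    rw [Bool.and_eq_true, beq_iff_eq, beq_iff_eq] at h''
    exact ⟨Fin.ext h''.1, Fin.ext h''.2⟩
  · refine h'.2.resolve_right fun h'' => h ?_
    rw [Bool.and_eq_true, beq_iff_eq, beq_iff_eq] at h''
    exact ⟨Fin.ext h''.1, Fin.ext h''.2⟩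

/-! ### Arbitrary starting constraints and arbitrary signatures on a cycle. -/

/-- For each vertex of the icosahedron, an involutory automorphism that moves it to `5`. -/
def icoMove (a : Fin 12) : Fin 12 → Fin 12 :=
  ![![5, 1, 9, 8, 4, 0, 11, 7, 3, 2, 10, 6], ![0, 5, 2, 10, 9, 1, 6, 11, 8, 4, 3, 7],
    ![6, 3, 5, 1, 10, 2, 0, 9, 11, 7, 4, 8], ![6, 7, 4, 5, 2, 3, 0, 1, 10, 11, 8, 9],
    ![0, 8, 7, 3, 5, 4, 6, 2, 1, 9, 11, 10], ![0, 1, 2, 3, 4, 5, 6, 7, 8, 9, 10, 11],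
    ![11, 7, 3, 2, 10, 6, 5, 1, 9, 8, 4, 0], ![6, 11, 8, 4, 3, 7, 0, 5, 2, 10, 9, 1],
    ![0, 9, 11, 7, 4, 8, 6, 3, 5, 1, 10, 2], ![0, 1, 10, 11, 8, 9, 6, 7, 4, 5, 2, 3],
    ![6, 2, 1, 9, 11, 10, 0, 8, 7, 3, 5, 4], ![6, 7, 8, 9, 10, 11, 0, 1, 2, 3, 4, 5]] a

theorem icoMove_self : ∀ a, icoMove a a = 5 := by decide

theorem icoMove_icoMove : ∀ a i, icoMove a (icoMove a i) = i := by decide +kernel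

theorem icoMove_adj : ∀ a i j, icoAdj (icoMove a i) (icoMove a j) = icoAdj i j := by
  decide +kernel

theorem icoMove_twist : ∀ a i ε, icoMove a (i + twist ε) = icoMove a i + twist ε := by
  decide +kernel

theorem IcoCloses.of_icoMove {x : ℕ → Fin 12} {n : ℕ} {ε : ℤˣ} {a : Fin 12}
    (h : IcoCloses (fun i => icoMove a (x i)) n ε) : IcoCloses x n ε := by
  obtain ⟨z, h1, h2, h3⟩ := h
  refine ⟨fun i => icoMove a (z i), fun i hi => ?_, fun i hi => ?_, ?_⟩
  · rw [← icoMove_adj a, icoMove_icoMove]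
    exact h1 i hi
  · rw [icoMove_adj]
    exact h2 i hi
  · rw [← icoMove_twist, icoMove_adj]
    exact h3

theorem icoCloses (x : ℕ → Fin 12) {n : ℕ} (hn : 3 ≤ n) (ε : ℤˣ) : IcoCloses x n ε :=
  (icoCloses_of_zero (icoMove_self (x 0)) hn ε).of_icoMove

theorem icoCloses_two {x : ℕ → Fin 12} {ε : ℤˣ} (h : ¬ (x 1 = x 0 + twist ε ∧ x 2 = x 0)) :
    IcoCloses x 2 ε := by
  refine (icoCloses_two_of_zero (icoMove_self (x 0)) fun h' => h ⟨?_, ?_⟩).of_icoMove (a := x 0)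
  · rw [← icoMove_icoMove (x 0) (x 1), h'.1, ← icoMove_twist, icoMove_icoMove]
  · rw [← icoMove_icoMove (x 0) (x 2), h'.2, icoMove_icoMove]

/-- A signed cycle whose `i`-th edge has the sign `t i` maps to the icosahedron so that the
`i`-th vertex is adjacent to `x i`, unless it is a triangle and an exceptional case occurs. -/
theorem exists_signed_cycle (x : ℕ → Fin 12) (t : ℕ → ℤˣ) {n : ℕ} (hn : 2 ≤ n)
    (h : n = 2 → ¬ (x 0 = x 1 + twist (t 1 * t 2) ∧ x 0 = x 2 + twist (t 0 * t 1))) :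
    ∃ z : ℕ → Fin 12, (∀ i ≤ n, icoAdj (z i) (x i)) ∧
      (∀ i < n, icoAdj (z i) (z (i + 1) + twist (t i))) ∧ icoAdj (z n) (z 0 + twist (t n)) := by
  -- Switching the `i`-th vertex by the product of the preceding signs makes every edge positive
  -- except the last, which gets the sign of the cycle.
  set e : ℕ → ℤˣ := fun i => ∏ m ∈ Finset.range i, t m with he
  have e0 : e 0 = 1 := by simp [he]
  have es : ∀ i, e (i + 1) = e i * t i := fun i => Finset.prod_range_succ _ _
  have H : IcoCloses (fun i => x i + twist (e i)) n (e (n + 1)) := by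
    rcases hn.eq_or_lt with rfl | hn
    · refine icoCloses_two fun h' => h rfl ?_
      simp only [es, e0, one_mul] at h'
      simp only [twist_one, add_zero] at h'
      obtain ⟨h1, h2⟩ := h'
      refine ⟨?_, h2.symm⟩
      have : x 1 = x 0 + twist (t 1 * t 2) := by
        have h3 : x 1 = x 0 + twist (t 0 * t 1 * t 2) + twist (t 0) := by
          rw [← h1, add_assoc, twist_add_twist, add_zero]
        rw [h3, add_assoc, ← twist_mul]
        congr 2
        rcases Int.units_eq_one_or (t 0) with h | h <;> rw [h] <;> simp
      rw [this, add_assoc, twist_add_twist, add_zero]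
    · exact icoCloses _ hn _
  obtain ⟨z, h1, h2, h3⟩ := H
  have hsq : ∀ i j : Fin 12, ∀ ε, icoAdj (i + twist ε) (j + twist ε) = icoAdj i j := by
    intro i j ε
    rw [icoAdj_twist, add_assoc, twist_add_twist, add_zero]
  refine ⟨fun i => z i + twist (e i), fun i hi => ?_, fun i hi => ?_, ?_⟩
  · have := h1 i hi
    rwa [icoAdj_twist]
  · have := h2 i hi
    have h4 : z (i + 1) + twist (e (i + 1)) + twist (t i) = z (i + 1) + twist (e i) := by
      rw [es, twist_mul, add_assoc, add_assoc (twist _), twist_add_twist, add_zero]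
    rw [h4, hsq]
    exact this
  · have h4 : z 0 + twist (e 0) + twist (t n) = z 0 + twist (e (n + 1)) + twist (e n) := by
      rw [e0, es, twist_mul, twist_one, add_zero, add_assoc, add_right_comm, twist_add_twist,
        zero_add]
    rw [h4, hsq]
    exact h3

/-! ### Colourings by the icosahedron, chordless cycles and the choice of a sign for a new edge. -/

section Coloring

variable {V : Type*}

/-- `f` maps the graph `G`, signed by `s`, to the icosahedron. -/
def IsIcoColoring (G : SimpleGraph V) (s : V → V → ℤˣ) (f : V → Fin 12) : Prop :=
  ∀ u v, G.Adj u v → icoAdj (f u) (f v + twist (s u v))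

/-- `K` spans a complete graph on four vertices all of whose triangles have the sign `ε`. -/
def IsUniformK4 (G : SimpleGraph V) (s : V → V → ℤˣ) (K : Finset V) (ε : ℤˣ) : Prop :=
  K.card = 4 ∧ G.IsClique K ∧
    ∀ u ∈ K, ∀ v ∈ K, ∀ w ∈ K, u ≠ v → v ≠ w → u ≠ w → s u v * s v w * s u w = ε

/-- The graph obtained from `G` by deleting all edges that meet `C`. -/
def isolate (G : SimpleGraph V) (C : Set V) : SimpleGraph V where
  Adj u v := G.Adj u v ∧ u ∉ C ∧ v ∉ C
  symm := ⟨fun _ _ h => ⟨h.1.symm, h.2.2, h.2.1⟩⟩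
  loopless := ⟨fun _ h => h.1.ne rfl⟩

theorem isolate_le (G : SimpleGraph V) (C : Set V) : isolate G C ≤ G := fun _ _ h => h.1

theorem IsUniformK4.mono {G H : SimpleGraph V} {s : V → V → ℤˣ} {K : Finset V} {ε : ℤˣ}
    (h : IsUniformK4 G s K ε) (hGH : G ≤ H) : IsUniformK4 H s K ε :=
  ⟨h.1, h.2.1.mono hGH, h.2.2⟩

theorem IsIcoColoring.extend {G : SimpleGraph V} {s : V → V → ℤˣ} (hs : ∀ u v, s u v = s v u)
    {C : Set V} {f g : V → Fin 12} (hf : IsIcoColoring (isolate G C) s f)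
    (hfg : ∀ v ∉ C, g v = f v)
    (hin : ∀ u ∈ C, ∀ v ∈ C, G.Adj u v → icoAdj (g u) (g v + twist (s u v)))
    (hout : ∀ u ∈ C, ∀ v ∉ C, G.Adj u v → icoAdj (g u) (f v + twist (s u v))) :
    IsIcoColoring G s g := by
  intro u v huv
  by_cases hu : u ∈ C <;> by_cases hv : v ∈ C
  · exact hin u hu v hv huv
  · rw [hfg v hv]
    exact hout u hu v hv huv
  · rw [hfg u hu, icoAdj_comm, icoAdj_twist, hs]
    exact hout v hv u hu huv.symm
  · rw [hfg u hu, hfg v hv]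
    exact hf u v ⟨huv, hu, hv⟩

/-- `c` enumerates `n + 1` vertices that form a cycle. -/
structure IsCycleFun (G : SimpleGraph V) (c : ℕ → V) (n : ℕ) : Prop where
  two_le : 2 ≤ n
  inj : ∀ i ≤ n, ∀ j ≤ n, c i = c j → i = j
  adj : ∀ i < n, G.Adj (c i) (c (i + 1))
  adj_last : G.Adj (c n) (c 0)

/-- A path can always be prolonged without turning back; if it never met itself, it would exceed the
number of vertices. -/
theorem exists_isCycleFun [Finite V] {G : SimpleGraph V} {a b : V} (hab : G.Adj a b)
    (hG : ∀ v w, G.Adj v w → ∃ u, u ≠ w ∧ G.Adj v u) : ∃ c n, IsCycleFun G c n := by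
  by_contra! hno
  have H : ∀ n, ∃ c : ℕ → V, (∀ i ≤ n + 1, ∀ j ≤ n + 1, c i = c j → i = j) ∧
      ∀ i < n + 1, G.Adj (c i) (c (i + 1)) := by
    intro n
    induction n with
    | zero =>
      refine ⟨fun i => if i = 0 then a else b, fun i hi j hj h => ?_, fun i hi => ?_⟩
      · have := hab.ne
        interval_cases i <;> interval_cases j <;> simp_all
      · obtain rfl : i = 0 := by omega
        simpa using hab
    | succ n ih =>
      obtain ⟨c, hinj, hadj⟩ := ih
      obtain ⟨u, hu, hu'⟩ := hG _ _ (hadj n (by omega)).symm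
      by_cases hex : ∃ i ≤ n + 1, c i = u
      · obtain ⟨i, hi, rfl⟩ := hex
        have h1 : i ≠ n + 1 := fun h => hu'.ne (by rw [h])
        have h2 : i ≠ n := fun h => hu (by rw [h])
        refine absurd ⟨by omega, fun j hj k hk h => ?_, fun j hj => ?_, ?_⟩
          (hno (fun j => c (i + j)) (n + 1 - i))
        · have := hinj _ (by omega) _ (by omega) h
          omega
        · exact hadj (i + j) (by omega)
        · rw [Nat.add_sub_cancel' hi]
          exact hu'
      · push Not at hex
        refine ⟨fun i => if i ≤ n + 1 then c i else u, fun i hi j hj h => ?_, fun i hi => ?_⟩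
        · by_cases h1 : i ≤ n + 1 <;> by_cases h2 : j ≤ n + 1 <;> simp only [h1, h2, if_true,
            if_false] at h
          · exact hinj i h1 j h2 h
          · exact absurd h (hex i h1)
          · exact absurd h.symm (hex j h2)
          · omega
        · rcases Nat.lt_succ_iff_lt_or_eq.1 hi with h | rfl
          · simpa [h.le, Nat.succ_le_of_lt h] using hadj i h
          · simpa using hu'
  obtain ⟨c, hc, -⟩ := H (Nat.card V)
  have hinj : Function.Injective fun i : Fin (Nat.card V + 1) => c i := fun i j h =>
    Fin.ext (hc i (by omega) j (by omega) h)
  have := Nat.card_le_card_of_injective _ hinj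
  simp at this

/-- In a shortest cycle a chord would cut off a shorter one. -/
theorem exists_chordless_isCycleFun {G : SimpleGraph V} (h : ∃ c n, IsCycleFun G c n) :
    ∃ c n, IsCycleFun G c n ∧ ∀ i j, i < j → j ≤ n → G.Adj (c i) (c j) →
      j = i + 1 ∨ i = 0 ∧ j = n := by
  classical
  have h' : ∃ n c, IsCycleFun G c n := by
    obtain ⟨c, n, h⟩ := h
    exact ⟨n, c, h⟩
  obtain ⟨c, hc⟩ := Nat.find_spec h'
  refine ⟨c, _, hc, fun i j hij hj hadj => ?_⟩
  by_contra! hne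
  have hlt : j - i < Nat.find h' := by
    by_contra hlt
    exact hne.2 (by omega) (by omega)
  refine Nat.find_min h' hlt ⟨fun m => c (i + m), by omega, fun a ha b hb hab => ?_,
    fun a ha => hc.adj _ (by omega), ?_⟩
  · have := hc.inj _ (by omega) _ (by omega) hab
    omega
  · rw [Nat.add_sub_cancel' hij.le]
    exact hadj.symm

theorem ncard_le_one_of_two_mem [Finite V] {S T : Set V} (hS : S.ncard ≤ 3) {a b : V} (ha : a ∈ S)
    (hb : b ∈ S) (hab : a ≠ b) (hT : T ⊆ S) (haT : a ∉ T) (hbT : b ∉ T) : T.ncard ≤ 1 := by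
  have h1 : (insert a (insert b T)).ncard ≤ S.ncard :=
    Set.ncard_le_ncard (Set.insert_subset ha (Set.insert_subset hb hT))
  rw [Set.ncard_insert_of_notMem (by simp [hab, haT]), Set.ncard_insert_of_notMem hbT] at h1
  omega

theorem exists_admissible {f : V → Fin 12} {s : V → V → ℤˣ} (v : V) {T : Set V}
    (hT : T.Subsingleton) : ∃ x : Fin 12, ∀ w ∈ T, x = f w + twist (s v w) := by
  rcases hT.eq_empty_or_singleton with rfl | ⟨w, rfl⟩
  · simp
  · exact ⟨_, by rintro _ rfl; rfl⟩

/-- The neighbours of `v` outside of `C`. -/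
def outerNbrs (G : SimpleGraph V) (C : Set V) (v : V) : Set V := {w | w ∉ C ∧ G.Adj v w}

theorem IsCycleFun.outerNbrs_subsingleton [Finite V] {G : SimpleGraph V} {c : ℕ → V} {n : ℕ}
    (hc : IsCycleFun G c n) (hdeg : ∀ v, (G.neighborSet v).ncard ≤ 3) {i : ℕ} (hi : i ≤ n) :
    (outerNbrs G (c '' Set.Iic n) (c i)).Subsingleton := by
  have hn := hc.two_le
  have : ∃ j ≤ n, ∃ k ≤ n, j ≠ k ∧ G.Adj (c i) (c j) ∧ G.Adj (c i) (c k) := by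
    rcases Nat.eq_zero_or_pos i with rfl | h0
    · exact ⟨1, by omega, n, le_rfl, by omega, hc.adj 0 (by omega), hc.adj_last.symm⟩
    · have hp := (hc.adj (i - 1) (by omega)).symm
      rw [Nat.sub_add_cancel h0] at hp
      rcases hi.eq_or_lt with rfl | hi
      · exact ⟨i - 1, by omega, 0, by omega, by omega, hp, hc.adj_last⟩
      · exact ⟨i - 1, by omega, i + 1, by omega, by omega, hp, hc.adj i hi⟩
  obtain ⟨j, hj, k, hk, hjk, haj, hak⟩ := this
  rw [← Set.ncard_le_one_iff_subsingleton]
  exact ncard_le_one_of_two_mem (hdeg (c i)) haj hak (fun h => hjk (hc.inj _ hj _ hk h))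
    (fun w hw => hw.2) (fun h => h.1 ⟨j, hj, rfl⟩) fun h => h.1 ⟨k, hk, rfl⟩

/-- A colouring of the complement of a chordless cycle extends to the cycle. -/
theorem IsCycleFun.exists_extension {G : SimpleGraph V} {s : V → V → ℤˣ}
    (hs : ∀ u v, s u v = s v u) {c : ℕ → V} {n : ℕ} (hc : IsCycleFun G c n)
    (hchord : ∀ i j, i < j → j ≤ n → G.Adj (c i) (c j) → j = i + 1 ∨ i = 0 ∧ j = n)
    {f : V → Fin 12} (hf : IsIcoColoring (isolate G (c '' Set.Iic n)) s f) (x : ℕ → Fin 12)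
    (hx : ∀ i ≤ n, ∀ w ∈ outerNbrs G (c '' Set.Iic n) (c i), x i = f w + twist (s (c i) w))
    (hex : n = 2 → ¬ (x 0 = x 1 + twist (s (c 1) (c 2) * s (c 2) (c 0)) ∧
      x 0 = x 2 + twist (s (c 0) (c 1) * s (c 1) (c 2)))) :
    ∃ g, IsIcoColoring G s g := by
  classical
  have hn := hc.two_le
  obtain ⟨z, hz, hz', hz''⟩ := exists_signed_cycle x
    (fun i => if i = n then s (c n) (c 0) else s (c i) (c (i + 1))) hn fun h => by
      subst h
      simpa using hex rfl
  have hg : ∃ g : V → Fin 12, (∀ i ≤ n, g (c i) = z i) ∧ ∀ v ∉ c '' Set.Iic n, g v = f v := by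
    refine ⟨fun v => if h : ∃ i ≤ n, c i = v then z h.choose else f v, fun i hi => ?_,
      fun v hv => ?_⟩
    · have h : ∃ j ≤ n, c j = c i := ⟨i, hi, rfl⟩
      refine (dif_pos h).trans ?_
      rw [hc.inj _ h.choose_spec.1 _ hi h.choose_spec.2]
    · exact dif_neg hv
  obtain ⟨g, hgz, hgf⟩ := hg
  have hlt : ∀ i j, i < j → j ≤ n → G.Adj (c i) (c j) →
      icoAdj (z i) (z j + twist (s (c i) (c j))) := by
    intro i j hij hj hadj
    rcases hchord i j hij hj hadj with rfl | ⟨rfl, rfl⟩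
    · have := hz' i (by omega)
      simpa [show i ≠ n by omega] using this
    · rw [hs, icoAdj_comm, icoAdj_twist]
      simpa using hz''
  refine ⟨g, hf.extend hs hgf ?_ ?_⟩
  · rintro _ ⟨i, hi, rfl⟩ _ ⟨j, hj, rfl⟩ hadj
    rw [hgz i hi, hgz j hj]
    rcases lt_trichotomy i j with h | rfl | h
    · exact hlt i j h hj hadj
    · exact absurd rfl hadj.ne
    · rw [hs, icoAdj_comm, icoAdj_twist]
      exact hlt j i h hi hadj.symm
  · rintro _ ⟨i, hi, rfl⟩ v hv hadj
    rw [hgz i hi, ← hx i hi v ⟨hv, hadj⟩]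
    exact hz i hi

/-- One of the two signs for a new edge `ab` creates no uniformly signed `K₄`. -/
theorem exists_sign_edge [Finite V] {G : SimpleGraph V} {s : V → V → ℤˣ}
    (hs : ∀ u v, s u v = s v u) (hG : ∀ K ε, ¬ IsUniformK4 G s K ε) {a b : V} (hab : a ≠ b)
    (hdeg : ((G ⊔ SimpleGraph.edge a b).neighborSet a).ncard ≤ 3) :
    ∃ s' : V → V → ℤˣ, (∀ u v, s' u v = s' v u) ∧ (∀ u v, G.Adj u v → s' u v = s u v) ∧ ∀ K ε, ¬ IsUniformK4 (G ⊔ SimpleGraph.edge a b) s' K ε := by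
  classical
  by_cases hadj : G.Adj a b
  · refine ⟨s, hs, fun _ _ _ => rfl, fun K ε h => hG K ε (h.mono ?_)⟩
    exact sup_le le_rfl ((SimpleGraph.edge_le_iff _).2 (Or.inr hadj))
  set t : ℤˣ → V → V → ℤˣ := fun δ u v => if s(u, v) = s(a, b) then δ else s u v with ht
  have htab : ∀ δ, t δ a b = δ := fun δ => by simp [ht]
  have htne : ∀ δ u v, s(u, v) ≠ s(a, b) → t δ u v = s u v := fun δ u v h => if_neg h
  -- A uniform `K₄` must use the new edge, and the degree bound at `a` then determines it, so both
  -- signs yield the same four vertices.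
  have hK : ∀ δ K ε, IsUniformK4 (G ⊔ SimpleGraph.edge a b) (t δ) K ε →
      a ∈ K ∧ b ∈ K ∧ (K.erase a : Set V) = (G ⊔ SimpleGraph.edge a b).neighborSet a := by
    intro δ K ε h
    have hmem : a ∈ K ∧ b ∈ K := by
      by_contra hmem
      have hne : ∀ u ∈ K, ∀ v ∈ K, s(u, v) ≠ s(a, b) := by
        intro u hu v hv h
        rcases Sym2.eq_iff.1 h with ⟨rfl, rfl⟩ | ⟨rfl, rfl⟩
        exacts [hmem ⟨hu, hv⟩, hmem ⟨hv, hu⟩]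
      refine hG K ε ⟨h.1, fun u hu v hv huv => ?_, fun u hu v hv w hw h1 h2 h3 => ?_⟩
      · refine (h.2.1 hu hv huv).resolve_right fun h => hne u hu v hv ?_
        rw [SimpleGraph.edge_adj] at h
        exact Sym2.eq_iff.2 h.1
      · rw [← h.2.2 u hu v hv w hw h1 h2 h3, htne _ _ _ (hne u hu v hv),
          htne _ _ _ (hne v hv w hw), htne _ _ _ (hne u hu w hw)]
    refine ⟨hmem.1, hmem.2, Set.eq_of_subset_of_ncard_le (fun v hv => ?_) ?_⟩
    · rw [Finset.mem_coe, Finset.mem_erase] at hv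
      exact h.2.1 hmem.1 hv.2 hv.1.symm
    · rw [Set.ncard_coe_finset, Finset.card_erase_of_mem hmem.1, h.1]
      exact hdeg
  have hsymm : ∀ δ u v, t δ u v = t δ v u := fun δ u v => by
    simp only [ht, Sym2.eq_swap (a := u), hs u v]
  by_contra! hno
  obtain ⟨K, ε, h1⟩ := hno (t 1) (hsymm 1) fun u v huv => htne _ _ _ fun h => hadj <| by
    rwa [← SimpleGraph.mem_edgeSet, ← h]
  obtain ⟨K', ε', h2⟩ := hno (t (-1)) (hsymm (-1)) fun u v huv => htne _ _ _ fun h =>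
    hadj <| by rwa [← SimpleGraph.mem_edgeSet, ← h]
  obtain ⟨ha, hb, hKa⟩ := hK _ _ _ h1
  obtain ⟨ha', hb', hKa'⟩ := hK _ _ _ h2
  obtain rfl : K = K' := by
    rw [← Finset.insert_erase ha, ← Finset.insert_erase ha', Finset.coe_injective
      (hKa.trans hKa'.symm)]
  have hcard : 1 < ((K.erase a).erase b).card := by
    rw [Finset.card_erase_of_mem (Finset.mem_erase.2 ⟨hab.symm, hb⟩), Finset.card_erase_of_mem ha,
      h1.1]
    norm_num
  obtain ⟨y, hy, z, hz, hyz⟩ := Finset.one_lt_card.1 hcard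
  simp only [Finset.mem_erase] at hy hz
  obtain ⟨hyb, hya, hy⟩ := hy
  obtain ⟨hzb, hza, hz⟩ := hz
  have hne : ∀ v, v ≠ a → v ≠ b → ∀ u, s(u, v) ≠ s(a, b) ∧ s(v, u) ≠ s(a, b) := by
    intro v hva hvb u
    constructor <;> intro h <;> rcases Sym2.eq_iff.1 h with ⟨h1, h2⟩ | ⟨h1, h2⟩ <;> simp_all
  -- The triangle `ayz` avoids the new edge, so both uniform signs agree; the triangle `aby`
  -- contains it, so they differ.
  have e1 := h1.2.2 a ha y hy z hz hya.symm hyz hza.symm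
  have e2 := h2.2.2 a ha y hy z hz hya.symm hyz hza.symm
  have e3 := h1.2.2 a ha b hb y hy hab hyb.symm hya.symm
  have e4 := h2.2.2 a ha b hb y hy hab hyb.symm hya.symm
  rw [htne _ _ _ (hne y hya hyb a).1, htne _ _ _ (hne y hya hyb z).2,
    htne _ _ _ (hne z hza hzb a).1] at e1 e2
  rw [htab, htne _ _ _ (hne y hya hyb b).1, htne _ _ _ (hne y hya hyb a).1] at e3 e4
  rw [e1] at e2
  subst e2
  rw [← e4] at e3
  revert e3
  rcases Int.units_eq_one_or (s b y) with h | h <;>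
    rcases Int.units_eq_one_or (s a y) with h' | h' <;> rw [h, h'] <;> decide

end Coloring

/-! ### The induction on the number of non-isolated vertices. -/

section Induction

variable {V : Type*}

theorem ne_add_twist_of_icoAdj : ∀ i j, icoAdj i j → ∀ ε, i ≠ j + twist ε := by decide +kernel

theorem add_one_ne_add_twist : ∀ i ε, i + 1 ≠ i + twist ε := by decide

theorem exists_icoAdj : ∀ i, ∃ j, icoAdj j i := by decide +kernel

theorem twist_injective : ∀ i ε δ, i + twist ε = i + twist δ → ε = δ := by decide

theorem isUniformK4_of_triangles [DecidableEq V] {G : SimpleGraph V} {s : V → V → ℤˣ}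
    (hs : ∀ u v, s u v = s v u) {a b c d : V} {ε : ℤˣ} (hab : G.Adj a b) (hac : G.Adj a c)
    (had : G.Adj a d) (hbc : G.Adj b c) (hbd : G.Adj b d) (hcd : G.Adj c d)
    (h1 : s a b * s b c * s a c = ε) (h2 : s a b * s b d * s a d = ε)
    (h3 : s a c * s c d * s a d = ε) (h4 : s b c * s c d * s b d = ε) :
    IsUniformK4 G s {a, b, c, d} ε := by
  refine ⟨?_, ?_, ?_⟩
  · simp [hab.ne, hac.ne, had.ne, hbc.ne, hbd.ne, hcd.ne]
  · intro u hu v hv huv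
    simp only [Finset.coe_insert, Finset.coe_singleton, Set.mem_insert_iff,
      Set.mem_singleton_iff] at hu hv
    rcases hu with rfl | rfl | rfl | rfl <;> rcases hv with rfl | rfl | rfl | rfl <;>
      first | exact absurd rfl huv | assumption | (apply SimpleGraph.Adj.symm; assumption)
  · intro u hu v hv w hw huv hvw huw
    simp only [Finset.mem_insert, Finset.mem_singleton] at hu hv hw
    have e1 := hs b a
    have e2 := hs c a
    have e3 := hs d a
    have e4 := hs c b
    have e5 := hs d b
    have e6 := hs d c
    rcases hu with rfl | rfl | rfl | rfl <;> rcases hv with rfl | rfl | rfl | rfl <;>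
      first
      | exact absurd rfl huv
      | (rcases hw with rfl | rfl | rfl | rfl <;>
          first
          | exact absurd rfl hvw
          | exact absurd rfl huw
          | (try simp only [e1, e2, e3, e4, e5, e6]
             first
             | (refine Eq.trans ?_ h1; ac_rfl)
             | (refine Eq.trans ?_ h2; ac_rfl)
             | (refine Eq.trans ?_ h3; ac_rfl)
             | (refine Eq.trans ?_ h4; ac_rfl)))

/-- Signed graphs with at most `n` non-isolated vertices, of maximum degree three and without
uniformly signed `K₄`, map to the icosahedron. -/
def ColorableUpTo (V : Type*) (n : ℕ) : Prop :=
  ∀ (G : SimpleGraph V) (s : V → V → ℤˣ), (∀ u v, s u v = s v u) → G.support.ncard ≤ n →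
    (∀ v, (G.neighborSet v).ncard ≤ 3) → (∀ K ε, ¬ IsUniformK4 G s K ε) →
    ∃ f, IsIcoColoring G s f

theorem ncard_le_of_subset_diff [Finite V] {S T C : Set V} {n : ℕ} (hS : S.ncard ≤ n + 1)
    (hT : T ⊆ S \ C) {v : V} (hv : v ∈ S) (hvC : v ∈ C) : T.ncard ≤ n := by
  have : T.ncard < S.ncard := Set.ncard_lt_ncard
    ⟨hT.trans Set.sdiff_subset, fun h => (hT (h hv)).2 hvC⟩
  omega

theorem support_isolate_subset (G : SimpleGraph V) (C : Set V) :
    (isolate G C).support ⊆ G.support \ C := by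
  rintro v ⟨w, h⟩
  exact ⟨⟨w, h.1⟩, h.2.1⟩

theorem ColorableUpTo.isolate [Finite V] {n : ℕ} (ih : ColorableUpTo V n) {G : SimpleGraph V}
    {s : V → V → ℤˣ} (hs : ∀ u v, s u v = s v u) (hn : G.support.ncard ≤ n + 1)
    (hdeg : ∀ v, (G.neighborSet v).ncard ≤ 3) (hK : ∀ K ε, ¬ IsUniformK4 G s K ε) {C : Set V}
    {v : V} (hv : v ∈ G.support) (hvC : v ∈ C) :
    ∃ f, IsIcoColoring (SignedGraph.isolate G C) s f :=
  ih _ s hs (ncard_le_of_subset_diff hn (support_isolate_subset G C) hv hvC)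
    (fun u => (Set.ncard_le_ncard fun _ h => h.1).trans (hdeg u))
    fun K ε h => hK K ε (h.mono (isolate_le G C))

/-- The induction hypothesis is applied with an extra edge `ab`: adjacent vertices of the
icosahedron lie on different lines. The degree bound is kept because `a` and `b` have each lost an
edge to `C`. -/
theorem ColorableUpTo.isolate_ne [Finite V] {n : ℕ} (ih : ColorableUpTo V n) {G : SimpleGraph V}
    {s : V → V → ℤˣ} (hs : ∀ u v, s u v = s v u) (hn : G.support.ncard ≤ n + 1)
    (hdeg : ∀ v, (G.neighborSet v).ncard ≤ 3) (hK : ∀ K ε, ¬ IsUniformK4 G s K ε) {C : Set V}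
    {a b u v : V} (hab : a ≠ b) (ha : a ∉ C) (hb : b ∉ C) (hu : u ∈ C) (hv : v ∈ C)
    (hua : G.Adj u a) (hvb : G.Adj v b) :
    ∃ f, IsIcoColoring (SignedGraph.isolate G C) s f ∧ ∀ ε, f a ≠ f b + twist ε := by
  have hend : ∀ a b u, a ∉ C → u ∈ C → G.Adj u a →
      (insert b ((SignedGraph.isolate G C).neighborSet a)).ncard ≤ 3 := by
    intro a b u ha hu hua
    have h1 : insert u ((SignedGraph.isolate G C).neighborSet a) ⊆ G.neighborSet a :=
      Set.insert_subset hua.symm fun _ h => h.1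
    have h2 := (Set.ncard_le_ncard h1).trans (hdeg a)
    rw [Set.ncard_insert_of_notMem fun h => h.2.2 hu] at h2
    exact (Set.ncard_insert_le _ _).trans h2
  have hdeg' : ∀ v, ((SignedGraph.isolate G C ⊔ SimpleGraph.edge a b).neighborSet v).ncard ≤ 3 := by
    intro w
    by_cases hwa : w = a
    · subst hwa
      refine (Set.ncard_le_ncard ?_).trans (hend w b u ha hu hua)
      rintro x (h | h)
      · exact Or.inr h
      · rw [SimpleGraph.edge_adj] at h
        rcases h.1 with h | h
        · exact Or.inl h.2
        · exact absurd h.1 hab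
    by_cases hwb : w = b
    · subst hwb
      refine (Set.ncard_le_ncard ?_).trans (hend w a v hb hv hvb)
      rintro x (h | h)
      · exact Or.inr h
      · rw [SimpleGraph.edge_adj] at h
        rcases h.1 with h | h
        · exact absurd h.1 hwa
        · exact Or.inl h.2
    · refine (Set.ncard_le_ncard ?_).trans (hdeg w)
      rintro x (h | h)
      · exact h.1
      · rw [SimpleGraph.edge_adj] at h
        exact (h.1.elim (fun h => hwa h.1) fun h => hwb h.1).elim
  obtain ⟨s', hs', hss', hK'⟩ := exists_sign_edge hs
    (fun K ε h => hK K ε (h.mono (isolate_le G C))) hab (hdeg' a)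
  have hsupp : (SignedGraph.isolate G C ⊔ SimpleGraph.edge a b).support ⊆ G.support \ C := by
    rintro w ⟨x, h | h⟩
    · exact support_isolate_subset G C ⟨x, h⟩
    · rw [SimpleGraph.edge_adj] at h
      rcases h.1 with ⟨rfl, rfl⟩ | ⟨rfl, rfl⟩
      · exact ⟨⟨u, hua.symm⟩, ha⟩
      · exact ⟨⟨v, hvb.symm⟩, hb⟩
  obtain ⟨f, hf⟩ := ih _ s' hs' (ncard_le_of_subset_diff hn hsupp ⟨a, hua⟩ hu) hdeg' hK'
  refine ⟨f, fun x y h => ?_, fun ε h => ?_⟩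
  · rw [← hss' x y h]
    exact hf x y (Or.inl h)
  · have hadj := hf a b (Or.inr ((SimpleGraph.edge_adj ..).2 ⟨Or.inl ⟨rfl, rfl⟩, hab⟩))
    refine ne_add_twist_of_icoAdj _ _ hadj (ε * s' a b) ?_
    rw [h, add_assoc, ← twist_mul, mul_comm ε, ← mul_assoc, Int.units_mul_self, one_mul]

theorem ColorableUpTo.of_pendant [Finite V] {n : ℕ} (ih : ColorableUpTo V n) {G : SimpleGraph V}
    {s : V → V → ℤˣ} (hs : ∀ u v, s u v = s v u) (hn : G.support.ncard ≤ n + 1)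
    (hdeg : ∀ v, (G.neighborSet v).ncard ≤ 3) (hK : ∀ K ε, ¬ IsUniformK4 G s K ε)
    {v w : V} (hvw : G.Adj v w) (hw : ∀ u, G.Adj v u → u = w) : ∃ f, IsIcoColoring G s f := by
  classical
  obtain ⟨f, hf⟩ := ih.isolate hs hn hdeg hK ⟨w, hvw⟩ (Set.mem_singleton v)
  obtain ⟨z, hz⟩ := exists_icoAdj (f w + twist (s v w))
  refine ⟨Function.update f v z, hf.extend hs (fun u hu => Function.update_of_ne hu _ _) ?_ ?_⟩
  · rintro _ rfl _ rfl h
    exact absurd rfl h.ne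
  · rintro _ rfl u - h
    rw [hw u h, Function.update_self]
    exact hz

/-- The values `x 0`, `x 1`, `x 2` do not lie on one line. -/
theorem not_exceptional {x : ℕ → Fin 12} {i j : ℕ} (hi : i ≤ 2) (hj : j ≤ 2)
    (hij : ∀ ε, x i ≠ x j + twist ε) (α β : ℤˣ) :
    ¬ (x 0 = x 1 + twist α ∧ x 0 = x 2 + twist β) := by
  rintro ⟨h1, h2⟩
  have key : ∀ i ≤ 2, ∃ ε, x i = x 0 + twist ε := by
    intro i hi
    interval_cases i
    · exact ⟨1, by simp⟩
    · exact ⟨α, by rw [h1, add_assoc, twist_add_twist, add_zero]⟩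
    · exact ⟨β, by rw [h2, add_assoc, twist_add_twist, add_zero]⟩
  obtain ⟨γ, hγ⟩ := key i hi
  obtain ⟨δ, hδ⟩ := key j hj
  refine hij (δ * γ) ?_
  rw [hγ, hδ, twist_mul, add_assoc, ← add_assoc (twist δ), twist_add_twist, zero_add]

theorem ColorableUpTo.of_triangle [Finite V] {n : ℕ} (ih : ColorableUpTo V n) {G : SimpleGraph V}
    {s : V → V → ℤˣ} (hs : ∀ u v, s u v = s v u) (hn : G.support.ncard ≤ n + 1)
    (hdeg : ∀ v, (G.neighborSet v).ncard ≤ 3) (hK : ∀ K ε, ¬ IsUniformK4 G s K ε)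
    {c : ℕ → V} (hc : IsCycleFun G c 2) : ∃ f, IsIcoColoring G s f := by
  classical
  set C := c '' Set.Iic 2 with hC
  have hchord : ∀ i j, i < j → j ≤ 2 → G.Adj (c i) (c j) → j = i + 1 ∨ i = 0 ∧ j = 2 := by
    intro i j _ _ _
    omega
  have hmem : ∀ i ≤ 2, c i ∈ C := fun i hi => ⟨i, hi, rfl⟩
  have hsub : ∀ i ≤ 2, (outerNbrs G C (c i)).Subsingleton := fun i hi =>
    hc.outerNbrs_subsingleton hdeg hi
  have hadm : ∀ f : V → Fin 12, ∃ x : ℕ → Fin 12, ∀ i ≤ 2, ∀ w ∈ outerNbrs G C (c i),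
      x i = f w + twist (s (c i) w) := by
    intro f
    have : ∀ i, ∃ x : Fin 12, i ≤ 2 → ∀ w ∈ outerNbrs G C (c i), x = f w + twist (s (c i) w) := by
      intro i
      by_cases hi : i ≤ 2
      · obtain ⟨x, hx⟩ := exists_admissible (f := f) (s := s) (c i) (hsub i hi)
        exact ⟨x, fun _ => hx⟩
      · exact ⟨0, fun h => absurd h hi⟩
    choose x hx using this
    exact ⟨x, hx⟩
  by_cases hne : ∃ i ≤ 2, ∃ j ≤ 2, ∃ a ∈ outerNbrs G C (c i), ∃ b ∈ outerNbrs G C (c j), a ≠ b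
  · obtain ⟨i, hi, j, hj, a, ha, b, hb, hab⟩ := hne
    obtain ⟨f, hf, hfab⟩ := ih.isolate_ne hs hn hdeg hK hab ha.1 hb.1 (hmem i hi) (hmem j hj)
      ha.2 hb.2
    obtain ⟨x, hx⟩ := hadm f
    refine hc.exists_extension hs hchord hf x hx fun _ => not_exceptional hi hj (fun ε h => ?_) _ _
    rw [hx i hi a ha, hx j hj b hb] at h
    refine hfab (s (c j) b * ε * s (c i) a) ?_
    rw [twist_mul, twist_mul, ← add_assoc, ← add_assoc, ← h, add_assoc, twist_add_twist, add_zero]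
  obtain ⟨f, hf⟩ := ih.isolate hs hn hdeg hK ⟨_, hc.adj 0 (by norm_num)⟩ (hmem 0 (by norm_num))
  obtain ⟨x, hx⟩ := hadm f
  by_cases hemp : ∃ i ≤ 2, outerNbrs G C (c i) = ∅
  · obtain ⟨i, hi, hempty⟩ := hemp
    obtain ⟨j, hj, hji⟩ : ∃ j ≤ 2, j ≠ i := by
      by_cases h : i = 0
      exacts [⟨1, by omega, by omega⟩, ⟨0, by omega, by omega⟩]
    -- The value at `i` is unconstrained; adding `1` moves it off the line of `x j`, as antipodes
    -- differ by `6`.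
    refine hc.exists_extension hs hchord hf (Function.update x i (x j + 1)) (fun k hk w hw => ?_)
      fun _ => not_exceptional hi hj (fun ε => ?_) _ _
    · have hki : k ≠ i := by
        rintro rfl
        exact (hempty ▸ hw : w ∈ (∅ : Set V))
      rw [Function.update_of_ne hki]
      exact hx k hk w hw
    · rw [Function.update_self, Function.update_of_ne hji]
      exact add_one_ne_add_twist _ _
  · push Not at hne hemp
    obtain ⟨w, hw⟩ := hemp 0 (by norm_num)
    have hw' : ∀ i ≤ 2, w ∈ outerNbrs G C (c i) := by
      intro i hi
      obtain ⟨v, hv⟩ := hemp i hi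
      rwa [hne 0 (by norm_num) i hi w hw v hv]
    refine hc.exists_extension hs hchord hf x hx fun _ hex => ?_
    have h01 := hc.adj 0 (by norm_num)
    have h12 := hc.adj 1 (by norm_num)
    have h0w := (hw' 0 (by norm_num)).2
    have h1w := (hw' 1 (by norm_num)).2
    have h2w := (hw' 2 (by norm_num)).2
    rw [hx 0 (by norm_num) w (hw' 0 (by norm_num)), hx 1 (by norm_num) w (hw' 1 (by norm_num)),
      hx 2 (by norm_num) w (hw' 2 (by norm_num)), add_assoc, add_assoc, ← twist_mul,
      ← twist_mul] at hex
    have e1 := twist_injective _ _ _ hex.1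
    have e2 := twist_injective _ _ _ hex.2
    -- The two equations of signs say that all four triangles of the `K₄` have the same sign.
    rw [hs (c 2) (c 0)] at e1
    refine hK _ _ (isUniformK4_of_triangles hs h01 hc.adj_last.symm h0w h12 h1w h2w rfl ?_ ?_ ?_)
    all_goals
      revert e1 e2
      simp only [zero_add]
      generalize s (c 0) (c 1) = p
      generalize s (c 1) (c 2) = q
      generalize s (c 0) (c 2) = r
      generalize s (c 0) w = l
      generalize s (c 1) w = m
      generalize s (c 2) w = n
      revert p q r l m n
      decide

theorem colorableUpTo (V : Type*) [Finite V] (n : ℕ) : ColorableUpTo V n := by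
  induction n with
  | zero =>
    intro G s _ hn _ _
    refine ⟨fun _ => 0, fun u v h => ?_⟩
    have : u ∈ G.support := ⟨v, h⟩
    rw [(Set.ncard_eq_zero).1 (Nat.le_zero.1 hn)] at this
    exact this.elim
  | succ n ih =>
    intro G s hs hn hdeg hK
    by_cases hE : ∃ a b, G.Adj a b
    · obtain ⟨a, b, hab⟩ := hE
      by_cases hp : ∃ v w, G.Adj v w ∧ ∀ u, G.Adj v u → u = w
      · obtain ⟨v, w, hvw, hw⟩ := hp
        exact ih.of_pendant hs hn hdeg hK hvw hw
      · push Not at hp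
        obtain ⟨c, m, hc, hchord⟩ := exists_chordless_isCycleFun (exists_isCycleFun hab
          fun v w hvw => (hp v w hvw).imp fun u h => ⟨h.2, h.1⟩)
        rcases hc.two_le.eq_or_lt with rfl | hm
        · exact ih.of_triangle hs hn hdeg hK hc
        · obtain ⟨f, hf⟩ := ih.isolate hs hn hdeg hK (C := c '' Set.Iic m)
            ⟨_, hc.adj 0 (by omega)⟩ ⟨0, Nat.zero_le _, rfl⟩
          have : ∀ i, ∃ x : Fin 12, i ≤ m → ∀ w ∈ outerNbrs G (c '' Set.Iic m) (c i),
              x = f w + twist (s (c i) w) := by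
            intro i
            by_cases hi : i ≤ m
            · obtain ⟨x, hx⟩ := exists_admissible (f := f) (s := s) (c i)
                (hc.outerNbrs_subsingleton hdeg hi)
              exact ⟨x, fun _ => hx⟩
            · exact ⟨0, fun h => absurd h hi⟩
          choose x hx using this
          exact hc.exists_extension hs hchord hf x hx fun h => by omega
    · push Not at hE
      exact ⟨fun _ => 0, fun u v h => absurd h (hE u v)⟩

end Induction

/-! ### From the icosahedron back to the target, and from uniform `K₄` to the excluded components.
-/

/-- Mappings that preserve the signs of edges after switching are homomorphisms. -/
theorem isHom_of_switching {V W : Type*} {S : SignedGraph V} {T : SignedGraph W}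
    {f : S.graph →g T.graph} (τ : V → ℤˣ)
    (h : ∀ u v (huv : S.graph.Adj u v),
      T.sign (f u) (f v) (f.map_adj huv) = τ u * τ v * S.sign u v huv) : S.IsHom T f := by
  have key : ∀ u v (p : S.graph.Walk u v),
      T.walkSign (p.map f) = τ u * τ v * S.walkSign p := by
    intro u v p
    induction p with
    | nil => simp [walkSign]
    | @cons u v w huv p ih =>
      rw [SimpleGraph.Walk.map_cons, walkSign, walkSign, ih, h u v huv]
      calc τ u * τ v * S.sign u v huv * (τ v * τ w * S.walkSign p)
          = τ v * τ v * (τ u * τ w * (S.sign u v huv * S.walkSign p)) := by ac_rfl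
        _ = _ := by rw [Int.units_mul_self, one_mul]
  intro v p
  rw [key, Int.units_mul_self, one_mul]

open Classical in
/-- The signature of `S`, extended to non-adjacent pairs by the value `1`. -/
noncomputable def pairSign {V : Type*} (S : SignedGraph V) (u v : V) : ℤˣ :=
  if h : S.graph.Adj u v then S.sign u v h else 1

theorem pairSign_of_adj {V : Type*} (S : SignedGraph V) {u v : V} (h : S.graph.Adj u v) :
    S.pairSign u v = S.sign u v h := dif_pos h

theorem pairSign_comm {V : Type*} (S : SignedGraph V) (u v : V) :
    S.pairSign u v = S.pairSign v u := by
  by_cases h : S.graph.Adj u v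
  · rw [pairSign_of_adj S h, pairSign_of_adj S h.symm, S.sign_symm]
  · rw [pairSign, pairSign, dif_neg h, dif_neg fun h' => h h'.symm]

/-- The vertex of `SP5plus` below a vertex of the icosahedron. -/
def icoProj (i : Fin 12) : Option (ZMod 5) :=
  ![some 0, some 1, some 2, some 3, some 4, none, some 0, some 1, some 2, some 3, some 4, none] i

/-- The sheet of the double cover of `SP5plus` in which a vertex lies. -/
def icoSheet (i : Fin 12) : ℤˣ := if i < 6 then 1 else -1

theorem icoProj_twist : ∀ i ε, icoProj (i + twist ε) = icoProj i := by decide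

theorem icoSheet_twist : ∀ i ε, icoSheet (i + twist ε) = icoSheet i * ε := by decide

theorem SP5plus_sign (i j : Fin 12) (h : icoAdj i j) :
    ∃ h : SP5plus.graph.Adj (icoProj i) (icoProj j),
      SP5plus.sign (icoProj i) (icoProj j) h = icoSheet i * icoSheet j := by
  have hsq : ∀ a : ZMod 5, IsSquare a ↔ a = 0 ∨ a = 1 ∨ a = 4 := by decide
  have hfin : ∀ a b : ZMod 5, ∀ ε : ℤˣ, a ≠ b →
      (if a - b = 0 ∨ a - b = 1 ∨ a - b = 4 then (1 : ℤˣ) else -1) = ε →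
      ∃ h : SP5plus.graph.Adj (some a) (some b), SP5plus.sign (some a) (some b) h = ε := by
    intro a b ε hab h
    refine ⟨hab, ?_⟩
    rw [← h]
    show (if IsSquare (a - b) then (1 : ℤˣ) else -1) = _
    simp only [hsq]
  have hleft : ∀ b : ZMod 5, ∀ ε : ℤˣ, 1 = ε →
      ∃ h : SP5plus.graph.Adj none (some b), SP5plus.sign none (some b) h = ε :=
    fun b ε h => ⟨trivial, h⟩
  have hright : ∀ b : ZMod 5, ∀ ε : ℤˣ, 1 = ε →
      ∃ h : SP5plus.graph.Adj (some b) none, SP5plus.sign (some b) none h = ε :=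
    fun b ε h => ⟨trivial, h⟩
  have hdec : ∀ i j, icoAdj i j →
      (∃ a b : ZMod 5, icoProj i = some a ∧ icoProj j = some b ∧ a ≠ b ∧
        (if a - b = 0 ∨ a - b = 1 ∨ a - b = 4 then (1 : ℤˣ) else -1) = icoSheet i * icoSheet j) ∨
      (∃ b : ZMod 5, icoProj i = none ∧ icoProj j = some b ∧ 1 = icoSheet i * icoSheet j) ∨
      ∃ b : ZMod 5, icoProj i = some b ∧ icoProj j = none ∧ 1 = icoSheet i * icoSheet j := by
    decide +kernel
  rcases hdec i j h with ⟨a, b, ha, hb, hab, h⟩ | ⟨b, ha, hb, h⟩ | ⟨b, ha, hb, h⟩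
  · rw [ha, hb]
    exact hfin a b _ hab h
  · rw [ha, hb]
    exact hleft b _ h
  · rw [ha, hb]
    exact hright b _ h

theorem IsIcoColoring.admitsHom {V : Type*} {S : SignedGraph V} {f : V → Fin 12}
    (hf : IsIcoColoring S.graph S.pairSign f) : S.AdmitsHom SP5plus := by
  have key : ∀ u v (h : S.graph.Adj u v),
      ∃ h' : SP5plus.graph.Adj (icoProj (f u)) (icoProj (f v)),
        SP5plus.sign (icoProj (f u)) (icoProj (f v)) h' =
          icoSheet (f u) * icoSheet (f v) * S.sign u v h := by
    intro u v h
    have := SP5plus_sign _ _ (hf u v h)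
    rw [icoProj_twist, icoSheet_twist, ← mul_assoc, pairSign_of_adj S h] at this
    exact this
  exact ⟨⟨fun v => icoProj (f v), fun {u v} h => (key u v h).1⟩,
    isHom_of_switching (fun v => icoSheet (f v)) fun u v h => (key u v h).2⟩

/-- The three neighbours inside `K` exhaust the degree of each vertex of `K`. -/
theorem IsUniformK4.mem_of_reachable {V : Type*} [Finite V] {G : SimpleGraph V} {s : V → V → ℤˣ}
    {K : Finset V} {ε : ℤˣ} (h : IsUniformK4 G s K ε) (hdeg : ∀ v, (G.neighborSet v).ncard ≤ 3)
    {u v : V} (huv : G.Reachable u v) (hu : u ∈ K) : v ∈ K := by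
  classical
  obtain ⟨p⟩ := huv
  induction p with
  | nil => exact hu
  | @cons u v w huv p ih =>
    refine ih ?_
    have : (K.erase u : Set V) = G.neighborSet u := by
      refine Set.eq_of_subset_of_ncard_le (fun v hv => ?_) ?_
      · rw [Finset.mem_coe, Finset.mem_erase] at hv
        exact h.2.1 hu hv.2 hv.1.symm
      · rw [Set.ncard_coe_finset, Finset.card_erase_of_mem hu, h.1]
        exact hdeg u
    have hv : v ∈ (K.erase u : Set V) := this ▸ huv
    exact Finset.mem_of_mem_erase hv

theorem IsUniformK4.exists_isomorphic {V : Type*} [Finite V] {S : SignedGraph V} {K : Finset V}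
    {ε : ℤˣ} (h : IsUniformK4 S.graph S.pairSign K ε)
    (hdeg : ∀ v, (S.graph.neighborSet v).ncard ≤ 3) :
    ∃ c : S.graph.ConnectedComponent,
      (S.induce c.supp).Isomorphic (complete (Fin 4) ε) := by
  classical
  obtain ⟨a, ha⟩ : K.Nonempty := Finset.card_pos.1 (by rw [h.1]; norm_num)
  have hmem : ∀ v, v ∈ (S.graph.connectedComponentMk a).supp ↔ v ∈ K := by
    intro v
    rw [SimpleGraph.ConnectedComponent.mem_supp_iff, SimpleGraph.ConnectedComponent.eq]
    refine ⟨fun hv => h.mem_of_reachable hdeg hv.symm ha, fun hv => ?_⟩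
    by_cases hva : v = a
    · rw [hva]
    · exact (h.2.1 hv ha hva).reachable
  refine ⟨S.graph.connectedComponentMk a, ?_⟩
  -- This switching gives all edges at `a` the sign `ε`; the triangles through `a` then force `ε` on
  -- the other edges.
  let τ : V → ℤˣ := fun v => if v = a then 1 else ε * S.pairSign a v
  have hτa : τ a = 1 := if_pos rfl
  have hτ : ∀ v, v ≠ a → τ v = ε * S.pairSign a v := fun v hv => if_neg hv
  have key : ∀ u ∈ K, ∀ v ∈ K, ∀ huv : S.graph.Adj u v, ε = τ u * τ v * S.sign u v huv := by
    intro u hu v hv huv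
    rw [← pairSign_of_adj]
    by_cases hua : u = a
    · subst hua
      rw [hτa, hτ v huv.ne.symm, one_mul, mul_assoc, Int.units_mul_self, mul_one]
    by_cases hva : v = a
    · subst hva
      rw [hτa, hτ u hua, pairSign_comm S u, mul_one, mul_assoc, Int.units_mul_self, mul_one]
    · have := h.2.2 a ha u hu v hv (Ne.symm hua) huv.ne (Ne.symm hva)
      rw [hτ u hua, hτ v hva]
      calc ε = S.pairSign a u * S.pairSign u v * S.pairSign a v := this.symm
        _ = ε * ε * (S.pairSign a u * S.pairSign u v * S.pairSign a v) := by
          rw [Int.units_mul_self, one_mul]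
        _ = _ := by ac_rfl
  let e : (S.induce (S.graph.connectedComponentMk a).supp).graph ≃g
      (complete (Fin 4) ε).graph :=
    { toEquiv := (Equiv.subtypeEquivRight hmem).trans (K.equivFinOfCardEq h.1)
      map_rel_iff' := by
        intro u v
        show _ ≠ _ ↔ S.graph.Adj u v
        rw [Ne, EmbeddingLike.apply_eq_iff_eq]
        refine ⟨fun huv => ?_, fun huv h => huv.ne (congrArg _ h)⟩
        exact h.2.1 ((hmem _).1 u.2) ((hmem _).1 v.2) fun h => huv (Subtype.ext h) }
  refine ⟨e, isHom_of_switching (fun v => τ v) fun u v huv =>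
    key u ((hmem _).1 u.2) v ((hmem _).1 v.2) huv,
    isHom_of_switching (fun i => τ (e.symm i)) fun i j hij => ?_⟩
  have hij' : S.graph.Adj (e.symm i) (e.symm j) := e.symm.map_adj_iff.2 hij
  have := key _ ((hmem _).1 (e.symm i).2) _ ((hmem _).1 (e.symm j).2) hij'
  show S.sign _ _ hij' = τ (e.symm i) * τ (e.symm j) * ε
  have swap : ∀ p q σ ε : ℤˣ, ε = p * q * σ → σ = p * q * ε := by decide
  exact swap _ _ _ _ this

end SignedGraph

theorem theorem1p13 {V : Type*} [Fintype V] (S : SignedGraph V) [DecidableRel S.graph.Adj]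
    (hsub : ∀ v : V, S.graph.degree v ≤ 3)
    (hpos : ∀ c : S.graph.ConnectedComponent,
      ¬ (S.induce c.supp).Isomorphic (SignedGraph.complete (Fin 4) 1))
    (hneg : ∀ c : S.graph.ConnectedComponent,
      ¬ (S.induce c.supp).Isomorphic (SignedGraph.complete (Fin 4) (-1))) :
    S.AdmitsHom SignedGraph.SP5plus := by
  have hdeg : ∀ v, (S.graph.neighborSet v).ncard ≤ 3 := by
    intro v
    rw [← Nat.card_coe_set_eq, Nat.card_eq_fintype_card, SimpleGraph.card_neighborSet_eq_degree]
    exact hsub v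
  obtain ⟨f, hf⟩ := SignedGraph.colorableUpTo V _ S.graph S.pairSign S.pairSign_comm le_rfl hdeg
    fun K ε hK => by
      obtain ⟨c, hc⟩ := hK.exists_isomorphic hdeg
      rcases Int.units_eq_one_or ε with rfl | rfl
      exacts [hpos c hc, hneg c hc]
  exact hf.admitsHom
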